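/- Let $K$ be a compact (Hausdorff) hypergroup with identity $e$, involution $x\mapsto\check x$ and convolution $*$ of bounded regular Borel measures; that is, $*$ is associative, each $\delta_x*\delta_y$ is a regular Borel probability measure with compact support, the maps $(x,y)\mapsto\delta_x*\delta_y$ and $(x,y)\mapsto\operatorname{supp}(\delta_x*\delta_y)$ are continuous for the weak topology and the Michael topology respectively, $\delta_e*\delta_x=\delta_x*\delta_e=\delta_x$, the involution is continuous with $(\delta_x*\delta_y)\check{\ }=\delta_{\check y}*\delta_{\check x}$, and $e\in\operatorname{supp}(\delta_x*\delta_y)$ if and only if $x=\check y$. Write $f(x*y)=\int_K f\,d(\delta_x*\delta_y)$; for bounded regular Borel measures $\mu,\nu$ one has $\int_K f\,d(\mu*\nu)=\int_K\int_K f(x*y)\,d\mu(x)\,d\nu(y)$ for all continuous $f$. Let $\omega$ be a left Haar measure on $K$, i.e. a non-zero positive Radon measure with $\delta_x*\omega=\omega$ for all $x\in K$, and let $L^p(K)=L^p(K,\omega)$ be the complex Lebesgue spaces. For $A,B\subseteq K$ put $A*B=\bigcup_{a\in A,\,b\in B}\operatorname{supp}(\delta_a*\delta_b)$, $A^1=A$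 and $A^{n+1}=A^n*A$. Let $\sigma$ be a regular Borel probability measure on $K$ that is adapted, i.e. $$K=\overline{\bigcup_{n=1}^\infty\bigl(\operatorname{supp}\sigma\cup(\operatorname{supp}\sigma)\check{\ }\bigr)^n}.$$ For $1\le p\le\infty$ let $H^p_\sigma(K)=\{f\in L^p(K):\sigma*f=f\}$, where $(\sigma*f)(x)=\int_K f(\check y*x)\,d\sigma(y)$ and the equation is an equality in $L^p(K)$, i.e. it holds $\omega$-almost everywhere. Then $H^p_\sigma(K)=\mathbb{C}1$ for every $1\le p\le\infty$; that is, the $\sigma$-harmonic $L^p$-functions on $K$ are exactly the (classes of) constant functions. -/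

import Mathlib

open MeasureTheory Topology
open scoped CompactlySupported ENNReal

/-- A (locally compact) hypergroup.  The convolution on the bounded regular Borel measures is
recorded by its values `conv x y = δ_x * δ_y` on point masses, which determine it through
`∫ f d(μ * ν) = ∫∫ (∫ f d(δ_x * δ_y)) dμ(x) dν(y)`. -/
class Hypergroup (K : Type*) [TopologicalSpace K] [T2Space K] [LocallyCompactSpace K]
    [MeasurableSpace K] [BorelSpace K] where
  /-- The probability measure `δ_x * δ_y`. -/
  conv : K → K → ProbabilityMeasure K
  /-- The identity `e`. -/
  one : K
  /-- The involution. -/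
  inv : K → K
  regular_conv : ∀ x y, (conv x y : Measure K).Regular
  isCompact_support_conv : ∀ x y, IsCompact (conv x y : Measure K).support
  /-- `(x, y) ↦ supp (δ_x * δ_y)` is continuous for the Michael (Vietoris) topology. -/
  continuous_support_conv : Continuous[instTopologicalSpaceProd, TopologicalSpace.vietoris K]
    fun q : K × K => (conv q.1 q.2 : Measure K).support
  /-- `(x, y) ↦ δ_x * δ_y` is continuous for the weak topology of measures. -/
  continuous_conv : Continuous fun q : K × K => conv q.1 q.2
  /-- `(δ_x * δ_y) * δ_z = δ_x * (δ_y * δ_z)`, tested against `C_c(K)`. -/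
  conv_assoc : ∀ (x y z : K) (f : C_c(K, ℂ)),
    ∫ s, (∫ t, f t ∂(conv s z : Measure K)) ∂(conv x y : Measure K) =
      ∫ s, (∫ t, f t ∂(conv x s : Measure K)) ∂(conv y z : Measure K)
  one_conv : ∀ x, (conv one x : Measure K) = Measure.dirac x
  conv_one : ∀ x, (conv x one : Measure K) = Measure.dirac x
  continuous_inv : Continuous inv
  inv_inv : ∀ x, inv (inv x) = x
  map_inv_conv : ∀ x y,
    (conv x y : Measure K).map inv = (conv (inv y) (inv x) : Measure K)
  one_mem_support_conv_iff : ∀ x y, one ∈ (conv x y : Measure K).support ↔ x = inv y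

namespace Hypergroup

variable {K : Type*} [TopologicalSpace K] [T2Space K] [LocallyCompactSpace K]
  [MeasurableSpace K] [BorelSpace K] [Hypergroup K]

/-- `f(x * y) = ∫ f d(δ_x * δ_y)`. -/
noncomputable def translate (f : K → ℂ) (x y : K) : ℂ :=
  ∫ t, f t ∂(conv x y : Measure K)

/-- The convolution `(μ * f)(x) = ∫ f(y̌ * x) dμ(y)` of a positive measure and a function. -/
noncomputable def measureConv (μ : Measure K) (f : K → ℂ) (x : K) : ℂ :=
  ∫ y, translate f (inv y) x ∂μ

/-- The Radon measure `ω` is a left Haar measure: `ω ≠ 0` and `δ_x * ω = ω` for all `x`, tested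
against `C_c(K)`. -/
structure IsLeftHaar (ω : Measure K) [ω.Regular] : Prop where
  ne_zero : ω ≠ 0
  left_invariant : ∀ (x : K) (f : C_c(K, ℂ)), ∫ t, translate f x t ∂ω = ∫ t, f t ∂ω

/-- The product of two subsets, `A * B = ⋃ supp (δ_a * δ_b)`. -/
def setMul (A B : Set K) : Set K :=
  ⋃ a ∈ A, ⋃ b ∈ B, (conv a b : Measure K).support

/-- The powers of a subset, with `A ^ 0 = {e}` (so that `A ^ 1 = A`). -/
def setPow (A : Set K) : ℕ → Set K
  | 0 => {one}
  | n + 1 => setMul (setPow A n) A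

/-- A positive measure `μ` is adapted if `⋃_{n ≥ 1} (supp μ ∪ (supp μ)ˇ) ^ n` is dense. -/
def IsAdapted (μ : Measure K) : Prop :=
  closure (⋃ n : ℕ, ⋃ _ : 1 ≤ n, setPow (μ.support ∪ inv '' μ.support) n) = Set.univ

/-- The space `H^p_σ(K)` of all `f ∈ L^p(K, ω)` with `σ * f = f` (almost everywhere, as an
equality in `L^p`). -/
def harmonicLp (σ ω : Measure K) (p : ℝ≥0∞) : Set (Lp ℂ p ω) :=
  {f | measureConv σ f =ᵐ[ω] f}

end Hypergroup

/-!
Write `P` for the random walk with transition probabilities `P x = σ̌ * δ_x`, so that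
`σ * f = ∫ f dP(·)` and `P` preserves `ω`. Let `f` be integrable and harmonic and let `φ` be a
strictly convex function of linear growth. Then `φ (f x) ≤ ∫ φ ∘ f d(P x)` by Jensen's inequality,
and both sides have the same integral against `ω`, so equality holds almost everywhere: the walk
almost surely never changes the value of `f`. Hence a level set `A` of `f` is left and entered with
probability zero, so the restriction of `ω` to `A` is again stationary for `P`.

A stationary finite measure `ν` is left invariant (Choquet–Deny): for continuous `g`, the function
`h w = ∫ g d(δ_w̌ * ν)` is continuous and harmonic for the walk with law `σ`, so by the same
equality case it is constant on the supports of the measures `δ_y * δ_x` with `y ∈ supp σ`, hence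
constant because `σ` is adapted. Since Haar measure is unique up to a factor, the restriction of `ω`
to `A` is a multiple of `ω`, so `A` is null or conull.
-/

open ProbabilityTheory

section Topology
variable {X : Type*} [TopologicalSpace X]

theorem isOpen_setOf_lt_of_upperSemicontinuous {β : Type*} [LinearOrder β] [DenselyOrdered β]
    {u f : X → β} (hu : UpperSemicontinuous u) (hf : LowerSemicontinuous f) :
    IsOpen {x | u x < f x} :=
  isOpen_iff_mem_nhds.2 fun x hx => by
    obtain ⟨c, huc, hcf⟩ := exists_between (show u x < f x from hx)
    filter_upwards [hu x c huc, hf x c hcf] with y hy hy' using hy.trans hy'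

variable [MeasurableSpace X]

theorem eq_zero_of_mem_support_of_integral_eq_zero {μ : Measure X} {g : X → ℝ}
    (hg : Continuous g) (hg₀ : 0 ≤ g) (hint : Integrable g μ) (h : ∫ x, g x ∂μ = 0)
    {x : X} (hx : x ∈ μ.support) : g x = 0 :=
  Measure.support_subset_of_isClosed (isClosed_singleton.preimage hg)
    ((integral_eq_zero_iff_of_nonneg hg₀ hint).1 h) hx

theorem support_dirac [T1Space X] [OpensMeasurableSpace X] (x : X) :
    (Measure.dirac x).support = {x} := by
  refine subset_antisymm (Measure.support_subset_of_isClosed isClosed_singleton ?_) ?_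
  · simp
  · rintro _ rfl
    refine (Measure.mem_support_iff_forall _).2 fun U hU => Measure.le_dirac_apply.trans_lt' ?_
    simp [mem_of_mem_nhds hU]

theorem lintegral_iSup_of_directed_of_lowerSemicontinuous [CompactSpace X] [BorelSpace X]
    (μ : Measure X) [IsFiniteMeasure μ] [μ.WeaklyRegular] {ι : Type*} [Nonempty ι]
    {f : ι → X → ℝ≥0∞} (hf : ∀ i, LowerSemicontinuous (f i)) (hdir : Directed (· ≤ ·) f) :
    ∫⁻ x, ⨆ i, f i x ∂μ = ⨆ i, ∫⁻ x, f i x ∂μ := by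
  refine le_antisymm ?_ (iSup_lintegral_le _)
  rw [lintegral_eq_nnreal]
  refine iSup₂_le fun φ hφ => ENNReal.le_of_forall_pos_le_add fun δ hδ _ => ?_
  rw [← SimpleFunc.lintegral_eq_lintegral]
  obtain ⟨ε, hε, hεδ⟩ : ∃ ε : ℝ≥0∞, 0 < ε ∧ ε * μ Set.univ + ε = δ := by
    refine ⟨δ / (μ Set.univ + 1), ENNReal.div_pos (by simpa using hδ.ne') (by finiteness), ?_⟩
    rw [← mul_add_one, ENNReal.div_mul_cancel (by simp) (by finiteness)]
  have hφ_ne_top : ∫⁻ x, φ x ∂μ ≠ ∞ :=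
    have ⟨C, hC⟩ := φ.exists_forall_le
    (IsFiniteMeasure.lintegral_lt_top_of_bounded_to_ennreal μ
      ⟨C, fun x => by exact_mod_cast hC x⟩).ne
  obtain ⟨g, hgφ, hg, hφg⟩ := φ.exists_upperSemicontinuous_le_lintegral_le hφ_ne_top hε.ne'
  have hopen (i : ι) : IsOpen {x | (g x : ℝ≥0∞) < f i x + ε} :=
    isOpen_setOf_lt_of_upperSemicontinuous
      (ENNReal.continuous_coe.comp_upperSemicontinuous hg ENNReal.coe_mono)
      ((hf i).add lowerSemicontinuous_const)
  have hcover (x : X) : ∃ i, (g x : ℝ≥0∞) < f i x + ε := by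
    have hgf : (g x : ℝ≥0∞) ≤ ⨆ i, f i x := le_trans (by exact_mod_cast hgφ x) (hφ x)
    rw [← lt_iSup_iff, ← ENNReal.iSup_add]
    exact (ENNReal.lt_add_right ENNReal.coe_ne_top hε.ne').trans_le (by gcongr)
  obtain ⟨i, hi⟩ := isCompact_univ.elim_directed_cover _ hopen
    (fun x _ => Set.mem_iUnion.2 (hcover x))
    (hdir.mono_comp (g := fun f => {x | (g x : ℝ≥0∞) < f x + ε}) _ fun f₁ f₂ h x
      (hx : (g x : ℝ≥0∞) < f₁ x + ε) => hx.trans_le (by gcongr; exact h x))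
  calc ∫⁻ x, φ x ∂μ ≤ ∫⁻ x, g x ∂μ + ε := hφg
    _ ≤ ∫⁻ x, (f i x + ε) ∂μ + ε := by gcongr with x; exact (hi (Set.mem_univ x)).le
    _ = ∫⁻ x, f i x ∂μ + δ := by
      rw [lintegral_add_right _ measurable_const, lintegral_const, add_assoc, hεδ]
    _ ≤ (⨆ i, ∫⁻ x, f i x ∂μ) + δ := by gcongr; exact le_iSup (fun i => ∫⁻ x, f i x ∂μ) i

theorem nonempty_support_of_regular {μ : Measure X} [μ.Regular] (hμ : μ ≠ 0) :
    μ.support.Nonempty := by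
  refine Set.nonempty_iff_ne_empty.2 fun hempty => hμ ?_
  rw [← Measure.measure_univ_eq_zero, ← Set.compl_empty, ← hempty]
  exact Measure.measure_compl_support_of_regular

end Topology

theorem compLeft_ofRealCLM_apply {X : Type*} [TopologicalSpace X] (g : C_c(X, ℝ)) (x : X) :
    g.compLeft (Complex.ofRealCLM : C(ℝ, ℂ)) x = g x :=
  CompactlySupportedContinuousMap.compLeft_apply (by simp) g x

section CompactSpace
variable {X Y : Type*} [TopologicalSpace X] [CompactSpace X] [MeasurableSpace X]
  [OpensMeasurableSpace X]

theorem integrable_of_continuous {E : Type*} [NormedAddCommGroup E] {μ : Measure X}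
    [IsFiniteMeasureOnCompacts μ] {g : X → E} (hg : Continuous g) : Integrable g μ :=
  hg.integrable_of_hasCompactSupport (.of_compactSpace g)

theorem continuous_integral_of_continuous_uncurry [TopologicalSpace Y] (μ : Measure X)
    [IsFiniteMeasureOnCompacts μ] {E : Type*} [NormedAddCommGroup E] [NormedSpace ℝ E]
    {f : Y → X → E} (hf : Continuous f.uncurry) :
    Continuous fun y => ∫ x, f y x ∂μ :=
  continuousOn_univ.1 <| continuousOn_integral_of_compact_support isCompact_univ hf.continuousOn
    fun _ x _ hx => absurd (Set.mem_univ x) hx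

end CompactSpace

section Kernel

theorem integral_kernel_comp {X Y E : Type*} [MeasurableSpace X] [MeasurableSpace Y]
    [NormedAddCommGroup E] [NormedSpace ℝ E] {μ : Measure X} {κ : Kernel X Y} {f : Y → E}
    (hf : Integrable f (κ ∘ₘ μ)) :
    ∫ y, f y ∂(κ ∘ₘ μ) = ∫ x, ∫ y, f y ∂κ x ∂μ := by
  rw [Measure.comp_eq_comp_const_apply] at hf ⊢
  rw [Kernel.integral_comp hf, Kernel.const_apply]

/-- The function `z ↦ √(1 + ‖z‖²)`: a strictly convex function of linear growth, so that Jensen's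
inequality with its equality case applies to integrable functions. -/
noncomputable def japaneseBracket {E : Type*} [NormedAddCommGroup E] (z : E) : ℝ :=
  ‖WithLp.toLp 2 (z, (1 : ℝ))‖

section JapaneseBracket
variable {E : Type*} [NormedAddCommGroup E]

theorem continuous_japaneseBracket : Continuous (japaneseBracket : E → ℝ) := by
  unfold japaneseBracket
  fun_prop

theorem strictConvexOn_japaneseBracket [InnerProductSpace ℝ E] :
    StrictConvexOn ℝ Set.univ (japaneseBracket : E → ℝ) := by
  refine ⟨convex_univ, fun x _ y _ hxy a b ha hb hab => ?_⟩
  set u := a • WithLp.toLp 2 (x, (1 : ℝ)) with hu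
  set v := b • WithLp.toLp 2 (y, (1 : ℝ)) with hv
  have huv : WithLp.toLp 2 (a • x + b • y, (1 : ℝ)) = u + v := by
    simp [hu, hv, ← WithLp.toLp_smul, ← WithLp.toLp_add, hab]
  have hray : ¬ SameRay ℝ u v := fun h => by
    obtain ⟨r, s, hr, -, hrs⟩ := h.exists_pos
      (fun h₀ => ha.ne' (by simpa [hu] using congrArg WithLp.snd h₀))
      (fun h₀ => hb.ne' (by simpa [hv] using congrArg WithLp.snd h₀))
    have h₁ : r • a • x = s • b • y := by simpa [hu, hv] using congrArg WithLp.fst hrs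
    have h₂ : r * a = s * b := by simpa [hu, hv] using congrArg WithLp.snd hrs
    rw [smul_smul, smul_smul, ← h₂] at h₁
    exact hxy (smul_right_injective E (mul_pos hr ha).ne' h₁)
  calc japaneseBracket (a • x + b • y) = ‖u + v‖ := by rw [japaneseBracket, huv]
    _ < ‖u‖ + ‖v‖ := norm_add_lt_of_not_sameRay hray
    _ = a • japaneseBracket x + b • japaneseBracket y := by
      rw [hu, hv, norm_smul_of_nonneg ha.le, norm_smul_of_nonneg hb.le]
      rfl

theorem japaneseBracket_le (z : E) : japaneseBracket z ≤ ‖z‖ + 1 := by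
  rw [japaneseBracket, WithLp.prod_norm_eq_of_L2]
  refine Real.sqrt_le_iff.2 ⟨by positivity, ?_⟩
  simp only [WithLp.toLp_fst, WithLp.toLp_snd, norm_one, one_pow]
  nlinarith [norm_nonneg z]

theorem integrable_japaneseBracket_comp {X : Type*} [MeasurableSpace X] {μ : Measure X}
    [IsFiniteMeasure μ] {f : X → E} (hf : Integrable f μ) :
    Integrable (fun x => japaneseBracket (f x)) μ :=
  (hf.norm.add (integrable_const 1)).mono'
    (continuous_japaneseBracket.comp_aestronglyMeasurable hf.aestronglyMeasurable)
    (.of_forall fun x => (norm_norm _).trans_le (japaneseBracket_le (f x)))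

end JapaneseBracket

section Invariant
variable {X : Type*} [MeasurableSpace X] {κ : Kernel X X} {μ : Measure X}

theorem ae_ae_eq_of_ae_integral_eq [IsMarkovKernel κ] [IsFiniteMeasure μ]
    (hκ : κ.Invariant μ) {E : Type*} [NormedAddCommGroup E]
    [InnerProductSpace ℝ E] [CompleteSpace E] {f : X → E} (hf : Integrable f μ)
    (hharm : ∀ᵐ x ∂μ, ∫ y, f y ∂κ x = f x) : ∀ᵐ x ∂μ, ∀ᵐ y ∂κ x, f y = f x := by
  have hκμ : κ ∘ₘ μ = μ := hκ
  have hφf : Integrable (fun x => japaneseBracket (f x)) (κ ∘ₘ μ) :=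
    hκμ.symm ▸ integrable_japaneseBracket_comp hf
  have hfκ : ∀ᵐ x ∂μ, Integrable f (κ x) :=
    Measure.ae_integrable_of_integrable_comp (hκμ.symm ▸ hf)
  have hjensen : ∀ᵐ x ∂μ, japaneseBracket (f x) ≤ ∫ y, japaneseBracket (f y) ∂κ x := by
    filter_upwards [hharm, hfκ] with x hx hfx
    rw [← hx]
    exact strictConvexOn_japaneseBracket.convexOn.map_integral_le
      continuous_japaneseBracket.continuousOn isClosed_univ (by simp) hfx
      (integrable_japaneseBracket_comp hfx)
  have heq : ∀ᵐ x ∂μ, japaneseBracket (f x) = ∫ y, japaneseBracket (f y) ∂κ x := by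
    refine (integral_eq_iff_of_ae_le (hκμ ▸ hφf) ?_ hjensen).1 ?_
    · rw [Measure.comp_eq_comp_const_apply] at hφf
      simpa only [Kernel.const_apply] using hφf.integral_comp
    · rw [← integral_kernel_comp hφf, hκμ]
  filter_upwards [hharm, hfκ, heq] with x hx hfx hφx
  rcases strictConvexOn_japaneseBracket.ae_eq_const_or_map_average_lt
    continuous_japaneseBracket.continuousOn isClosed_univ (by simp) hfx
    (integrable_japaneseBracket_comp hfx) with h | h
  · rwa [average_eq_integral, hx] at h
  · simp only [average_eq_integral, hx, hφx, lt_self_iff_false] at h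

theorem invariant_restrict (hκ : κ.Invariant μ) {A : Set X} (hA : MeasurableSet A)
    (h : ∀ᵐ x ∂μ, ∀ᵐ y ∂κ x, y ∈ A ↔ x ∈ A) : κ.Invariant (μ.restrict A) := by
  refine Measure.ext fun B hB => ?_
  have hκμ : κ ∘ₘ μ = μ := hκ
  rw [Measure.bind_apply hB κ.aemeasurable, Measure.restrict_apply hB, ← lintegral_indicator hA]
  conv_rhs => rw [← hκμ, Measure.bind_apply (hB.inter hA) κ.aemeasurable]
  refine lintegral_congr_ae (h.mono fun x hx => ?_)
  by_cases hxA : x ∈ A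
  · rw [Set.indicator_of_mem hxA]
    exact measure_congr (hx.mono fun y hy => propext (and_iff_left (hy.2 hxA)).symm)
  · rw [Set.indicator_of_notMem hxA, eq_comm]
    exact measure_eq_zero_iff_ae_notMem.2 (hx.mono fun y hy => by simp [hxA, hy])

end Invariant

end Kernel

section Feller
variable {X Y : Type*} [TopologicalSpace X] [TopologicalSpace Y] [T2Space Y]
  [LocallyCompactSpace Y] [MeasurableSpace Y]

theorem measure_eq_iSup_of_isOpen (μ : Measure Y) [μ.Regular] {U : Set Y} (hU : IsOpen U) :
    μ U = ⨆ V : {V : Set Y // IsOpen V ∧ IsCompact (closure V) ∧ closure V ⊆ U}, μ V := by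
  refine le_antisymm ?_ (iSup_le fun V => measure_mono (subset_closure.trans V.2.2.2))
  rw [hU.measure_eq_iSup_isCompact]
  refine iSup₂_le fun C hCU => iSup_le fun hC => ?_
  obtain ⟨V, hV, hCV, hVU, hVc⟩ := exists_open_between_and_isCompact_closure hC hU hCU
  exact le_iSup_of_le ⟨V, hV, hVc, hVU⟩ (measure_mono hCV)

theorem lowerSemicontinuous_measure_of_isOpen [OpensMeasurableSpace Y]
    {m : X → ProbabilityMeasure Y} (hm : Continuous m)
    (hreg : ∀ x, (m x : Measure Y).Regular) {U : Set Y} (hU : IsOpen U) :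
    LowerSemicontinuous fun x => (m x : Measure Y) U := by
  intro x c hc
  have := hreg x
  obtain ⟨C, hCU, hC, hcC⟩ := hU.exists_lt_isCompact hc
  obtain ⟨g, hg_one, hg_zero, -, hg⟩ := exists_continuous_one_zero_of_isCompact hC
    hU.isClosed_compl (Set.disjoint_compl_right_iff_subset.2 hCU)
  let G := (BoundedContinuousFunction.ofNormedAddCommGroup g g.continuous 1 fun y =>
    abs_le.2 ⟨by linarith [(hg y).1], (hg y).2⟩).nnrealPart
  have hG (y : Y) : (G y : ℝ≥0∞) = ENNReal.ofReal (g y) := rfl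
  have hlow : (m x : Measure Y) C ≤ ∫⁻ y, G y ∂(m x : Measure Y) := by
    rw [← lintegral_indicator_one hC.measurableSet]
    refine lintegral_mono (Set.indicator_le fun y hy => ?_)
    simp [hG, hg_one hy]
  have hupp (z : X) : ∫⁻ y, G y ∂(m z : Measure Y) ≤ (m z : Measure Y) U := by
    rw [← lintegral_indicator_one hU.measurableSet]
    refine lintegral_mono fun y => ?_
    by_cases hy : y ∈ U
    · simpa [hG, hy] using (hg y).2
    · simp [hG, hg_zero hy]
  filter_upwards [(ProbabilityMeasure.tendsto_iff_forall_lintegral_tendsto.1 (hm.tendsto x) G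
    ).eventually_const_lt (hcC.trans_le hlow)] with z hz
  exact hz.trans_le (hupp z)

variable [BorelSpace Y] [MeasurableSpace X] [OpensMeasurableSpace X]

/-- The Markov kernel given by a weakly continuous family of regular probability measures. The
target need not be second countable; regularity is what makes the family measurable. -/
noncomputable def fellerKernel (m : C(X, ProbabilityMeasure Y))
    (hreg : ∀ x, (m x : Measure Y).Regular) : Kernel X Y where
  toFun x := m x
  measurable' := .measure_of_isPiSystem_of_isProbabilityMeasure (S := {U : Set Y | IsOpen U})
    BorelSpace.measurable_eq isPiSystem_isOpen fun _ hU =>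
      (lowerSemicontinuous_measure_of_isOpen m.continuous hreg hU).measurable

instance (m : C(X, ProbabilityMeasure Y)) (hreg : ∀ x, (m x : Measure Y).Regular) :
    IsMarkovKernel (fellerKernel m hreg) :=
  ⟨fun x => inferInstanceAs (IsProbabilityMeasure (m x : Measure Y))⟩

theorem fellerKernel_comp_isOpen_eq_iSup [CompactSpace X] [BorelSpace X]
    (m : C(X, ProbabilityMeasure Y)) (hreg : ∀ x, (m x : Measure Y).Regular) (μ : Measure X)
    [IsFiniteMeasure μ] [μ.WeaklyRegular] {U : Set Y} (hU : IsOpen U) :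
    (fellerKernel m hreg ∘ₘ μ) U =
      ⨆ V : {V : Set Y // IsOpen V ∧ IsCompact (closure V) ∧ closure V ⊆ U},
        (fellerKernel m hreg ∘ₘ μ) V := by
  have : Nonempty {V : Set Y // IsOpen V ∧ IsCompact (closure V) ∧ closure V ⊆ U} :=
    ⟨∅, by simp⟩
  have happly {V : Set Y} (hV : IsOpen V) :
      (fellerKernel m hreg ∘ₘ μ) V = ∫⁻ x, (m x : Measure Y) V ∂μ :=
    Measure.bind_apply hV.measurableSet (Kernel.aemeasurable _)
  calc (fellerKernel m hreg ∘ₘ μ) U = ∫⁻ x, (m x : Measure Y) U ∂μ := happly hU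
    _ = ∫⁻ x, ⨆ V : {V : Set Y // IsOpen V ∧ IsCompact (closure V) ∧ closure V ⊆ U},
          (m x : Measure Y) V ∂μ := by
      congr with x
      have := hreg x
      exact measure_eq_iSup_of_isOpen _ hU
    _ = _ := by
      rw [lintegral_iSup_of_directed_of_lowerSemicontinuous μ
        (fun V => lowerSemicontinuous_measure_of_isOpen m.continuous hreg V.2.1)]
      · exact iSup_congr fun V => (happly V.2.1).symm
      · rintro ⟨V, hV, hVc, hVU⟩ ⟨W, hW, hWc, hWU⟩
        refine ⟨⟨V ∪ W, hV.union hW, ?_, ?_⟩, fun x => measure_mono Set.subset_union_left,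
          fun x => measure_mono Set.subset_union_right⟩
        · rw [closure_union]
          exact hVc.union hWc
        · rw [closure_union]
          exact Set.union_subset hVU hWU

instance regular_fellerKernel_comp [CompactSpace X] [BorelSpace X] (m : C(X, ProbabilityMeasure Y))
    (hreg : ∀ x, (m x : Measure Y).Regular) (μ : Measure X) [IsFiniteMeasure μ]
    [μ.WeaklyRegular] : (fellerKernel m hreg ∘ₘ μ).Regular := by
  have hinner : Measure.InnerRegularWRT (fellerKernel m hreg ∘ₘ μ) IsCompact IsOpen := by
    intro U hU r hr
    rw [fellerKernel_comp_isOpen_eq_iSup m hreg μ hU, lt_iSup_iff] at hr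
    obtain ⟨⟨V, hV, hVc, hVU⟩, hrV⟩ := hr
    exact ⟨closure V, hVU, hVc, hrV.trans_le (measure_mono subset_closure)⟩
  have : (fellerKernel m hreg ∘ₘ μ).WeaklyRegular :=
    Measure.InnerRegularWRT.weaklyRegular_of_finite _ fun U hU r hr =>
      have ⟨C, hCU, hC, hrC⟩ := hinner hU r hr
      ⟨C, hCU, hC.isClosed, hrC⟩
  exact ⟨hinner⟩

end Feller

namespace Hypergroup

section LocallyCompact

variable {K : Type*} [TopologicalSpace K] [T2Space K] [LocallyCompactSpace K]
  [MeasurableSpace K] [BorelSpace K] [Hypergroup K]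

instance regular_coe_conv (x y : K) : (conv x y : Measure K).Regular := regular_conv x y

/-- The support of `δ_x * δ_y`. -/
abbrev supp (x y : K) : Set K := (conv x y : Measure K).support

theorem mem_setMul {A B : Set K} {u : K} :
    u ∈ setMul A B ↔ ∃ a ∈ A, ∃ b ∈ B, u ∈ supp a b := by
  simp [setMul]

theorem supp_one_left (x : K) : supp one x = {x} := by
  rw [supp, one_conv, support_dirac]

theorem supp_one_right (x : K) : supp x one = {x} := by
  rw [supp, conv_one, support_dirac]

theorem one_mem_supp_inv_right (x : K) : one ∈ supp x (inv x) :=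
  (one_mem_support_conv_iff _ _).2 (inv_inv x).symm

theorem inv_one : inv (one : K) = one :=
  ((one_mem_support_conv_iff _ _).1 (by simp [support_dirac, one_conv])).symm

/-- The involution as a homeomorphism. -/
def invHomeomorph (K : Type*) [TopologicalSpace K] [T2Space K] [LocallyCompactSpace K]
    [MeasurableSpace K] [BorelSpace K] [Hypergroup K] : K ≃ₜ K where
  toFun := inv
  invFun := inv
  left_inv := inv_inv
  right_inv := inv_inv
  continuous_toFun := continuous_inv
  continuous_invFun := continuous_inv

instance regular_map_inv (μ : Measure K) [μ.Regular] : (μ.map inv).Regular :=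
  Measure.Regular.map (invHomeomorph K)

instance isProbabilityMeasure_map_inv (τ : Measure K) [IsProbabilityMeasure τ] :
    IsProbabilityMeasure (τ.map inv) :=
  Measure.isProbabilityMeasure_map continuous_inv.aemeasurable

theorem map_inv_map_inv (μ : Measure K) : (μ.map inv).map inv = μ := by
  rw [Measure.map_map continuous_inv.measurable continuous_inv.measurable,
    show inv ∘ inv = id from funext inv_inv, Measure.map_id]

theorem integral_map_inv {E : Type*} [NormedAddCommGroup E] [NormedSpace ℝ E] (μ : Measure K)
    (f : K → E) : ∫ t, f t ∂(μ.map inv) = ∫ t, f (inv t) ∂μ :=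
  integral_map_equiv (invHomeomorph K).toMeasurableEquiv f

theorem mem_support_map_inv {μ : Measure K} {x : K} :
    x ∈ (μ.map inv).support ↔ inv x ∈ μ.support := by
  have subset (μ : Measure K) : inv ⁻¹' μ.support ⊆ (μ.map inv).support := fun x hx =>
    (Measure.mem_support_iff_forall x).2 fun U hU => by
      rw [show (μ.map inv) U = μ (inv ⁻¹' U) from
        (invHomeomorph K).toMeasurableEquiv.map_apply U]
      refine (Measure.mem_support_iff_forall _).1 hx _
        (continuous_inv.continuousAt.preimage_mem_nhds ?_)
      rwa [inv_inv]
  refine ⟨fun hx => ?_, fun hx => subset μ hx⟩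
  have := subset (μ.map inv) (show inv (inv x) ∈ (μ.map inv).support by rwa [inv_inv])
  rwa [map_inv_map_inv] at this

theorem mem_supp_inv_inv {x y z : K} : z ∈ supp (inv y) (inv x) ↔ inv z ∈ supp x y := by
  rw [supp, ← map_inv_conv, mem_support_map_inv]

theorem isClosed_setOf_forall_mem_supp {X : Type*} [TopologicalSpace X] {a b : X → K}
    (ha : Continuous a) (hb : Continuous b) {E : Set (X × K)} (hE : IsClosed E) :
    IsClosed {x | ∀ t ∈ supp (a x) (b x), (x, t) ∈ E} := by
  let := TopologicalSpace.vietoris K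
  refine isOpen_compl_iff.1 (isOpen_iff_mem_nhds.2 fun x hx => ?_)
  obtain ⟨t, ht, hxt⟩ : ∃ t ∈ supp (a x) (b x), (x, t) ∉ E := by simpa using hx
  obtain ⟨U, hU, V, hV, hUV⟩ := mem_nhds_prod_iff.1 (hE.isOpen_compl.mem_nhds hxt)
  have hmeets : IsOpen {x | (supp (a x) (b x) ∩ interior V).Nonempty} :=
    ((TopologicalSpace.vietoris.isOpen_inter_nonempty_of_isOpen isOpen_interior).preimage
      continuous_support_conv).preimage (ha.prodMk hb)
  filter_upwards [hU, hmeets.mem_nhds ⟨t, ht, mem_interior_iff_mem_nhds.2 hV⟩]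
    with x' hx' ⟨t', ht', ht'V⟩ h
  exact hUV (Set.mk_mem_prod hx' (interior_subset ht'V)) (h t' ht')

theorem isClosed_setOf_mem_supp : IsClosed {q : (K × K) × K | q.2 ∈ supp q.1.1 q.1.2} := by
  let := TopologicalSpace.vietoris K
  refine isOpen_compl_iff.1 (isOpen_iff_mem_nhds.2 ?_)
  rintro ⟨⟨a, b⟩, u⟩ hu
  obtain ⟨V, W, hV, hW, hsub, huW, hVW⟩ := SeparatedNhds.of_isCompact_isCompact
    (isCompact_support_conv a b) (isCompact_singleton (x := u))
    (Set.disjoint_singleton_right.2 hu)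
  have hV' : IsOpen {q : (K × K) × K | supp q.1.1 q.1.2 ⊆ V} :=
    (hV.powerset_vietoris.preimage continuous_support_conv).preimage continuous_fst
  filter_upwards [hV'.mem_nhds hsub, (hW.preimage continuous_snd).mem_nhds
    (show ((a, b), u) ∈ _ from huW rfl)] with q hq hq' hmem
  exact Set.disjoint_left.1 hVW (hq hmem) hq'

theorem isClosed_setMul {A B : Set K} (hA : IsCompact A) (hB : IsCompact B) :
    IsClosed (setMul A B) := by
  have := isCompact_iff_compactSpace.1 (hA.prod hB)
  have hclosed : IsClosed {q : ↥(A ×ˢ B) × K | q.2 ∈ supp q.1.1.1 q.1.1.2} :=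
    isClosed_setOf_mem_supp.preimage (f := fun q : ↥(A ×ˢ B) × K => (q.1.1, q.2)) (by fun_prop)
  convert isClosedMap_snd_of_compactSpace _ hclosed using 1
  ext u
  simp [mem_setMul, and_assoc]

theorem continuous_integral_conv (g : BoundedContinuousFunction K ℝ) :
    Continuous fun q : K × K => ∫ t, g t ∂(conv q.1 q.2 : Measure K) :=
  ProbabilityMeasure.continuous_iff_forall_continuous_integral.1 continuous_conv g

theorem integral_conv_assoc_real (g : C_c(K, ℝ)) (x y z : K) :
    ∫ s, (∫ t, g t ∂(conv s z : Measure K)) ∂(conv x y : Measure K) =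
      ∫ s, (∫ t, g t ∂(conv x s : Measure K)) ∂(conv y z : Measure K) := by
  have h := conv_assoc x y z (g.compLeft (Complex.ofRealCLM : C(ℝ, ℂ)))
  simp only [compLeft_ofRealCLM_apply, integral_complex_ofReal] at h
  exact_mod_cast h

theorem exists_mem_supp_of_mem_supp {x y z t u : K} (ht : t ∈ supp x y) (hu : u ∈ supp t z) :
    ∃ s ∈ supp y z, u ∈ supp x s := by
  -- A bump function at `u` vanishing on `x * (y * z)` would contradict associativity.
  suffices u ∈ setMul {x} (supp y z) by simpa [mem_setMul] using this
  by_contra hu'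
  obtain ⟨g, hg_one, hg_zero, hg_supp, hg⟩ := exists_continuous_one_zero_of_isCompact
    isCompact_singleton (isClosed_setMul isCompact_singleton (isCompact_support_conv y z))
    (Set.disjoint_singleton_left.2 hu')
  let G : C_c(K, ℝ) := ⟨g, hg_supp⟩
  let h (t : K) : ℝ := ∫ w, G w ∂(conv t z : Measure K)
  have hG₀ : 0 ≤ ⇑G := fun w => (hg w).1
  have hh : Continuous h :=
    (continuous_integral_conv G.toBoundedContinuousFunction).comp
      (continuous_id.prodMk continuous_const)
  have hh_int : Integrable h (conv x y : Measure K) :=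
    .of_bound hh.aestronglyMeasurable 1 <| .of_forall fun t => by
      simpa using norm_integral_le_of_norm_le_const (μ := (conv t z : Measure K)) (f := G) (C := 1)
        (.of_forall fun w => abs_le.2 ⟨neg_one_lt_zero.le.trans (hg w).1, (hg w).2⟩)
  have hh_zero : ∫ t, h t ∂(conv x y : Measure K) = 0 := by
    rw [integral_conv_assoc_real]
    refine integral_eq_zero_of_ae ?_
    filter_upwards [Measure.support_mem_ae_of_regular] with s hs
    refine integral_eq_zero_of_ae ?_
    filter_upwards [Measure.support_mem_ae_of_regular] with w hw
    exact hg_zero (mem_setMul.2 ⟨x, rfl, s, hs, hw⟩)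
  have hht : h t = 0 := eq_zero_of_mem_support_of_integral_eq_zero hh
    (fun t => integral_nonneg hG₀) hh_int hh_zero ht
  have hgu : G u = 0 := eq_zero_of_mem_support_of_integral_eq_zero G.continuous hG₀
    (G.continuous.integrable_of_hasCompactSupport hg_supp) hht hu
  exact one_ne_zero ((hg_one rfl).symm.trans hgu)

theorem mem_supp_inv_of_mem_supp {x y z : K} (h : z ∈ supp x y) : x ∈ supp z (inv y) := by
  obtain ⟨s, hs, hs'⟩ := exists_mem_supp_of_mem_supp h (one_mem_supp_inv_right z)
  obtain rfl := (one_mem_support_conv_iff _ _).1 hs'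
  rwa [← inv_inv y, mem_supp_inv_inv] at hs

theorem mem_supp_of_mem_supp_inv {x y z : K} (h : z ∈ supp (inv y) x) : x ∈ supp y z := by
  rw [← inv_inv x, mem_supp_inv_inv] at h
  simpa [mem_supp_inv_inv, inv_inv] using mem_supp_inv_of_mem_supp h

theorem IsAdapted.eq_univ_of_isClosed {τ : Measure K} (hτ : IsAdapted τ) {M : Set K}
    (hM : IsClosed M) (hτM : τ.support ⊆ M) (hone : one ∈ M) (hinv : ∀ x ∈ M, inv x ∈ M)
    (hmul : setMul M M ⊆ M) : M = Set.univ := by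
  have hgen : τ.support ∪ inv '' τ.support ⊆ M :=
    Set.union_subset hτM (Set.image_subset_iff.2 fun x hx => hinv x (hτM hx))
  have hpow (n : ℕ) : setPow (τ.support ∪ inv '' τ.support) n ⊆ M := by
    induction n with
    | zero => simpa [setPow] using hone
    | succ n ih =>
      exact (Set.biUnion_mono ih fun _ _ => Set.biUnion_mono hgen fun _ _ => subset_rfl).trans hmul
  exact Set.univ_subset_iff.1 <|
    hτ.symm.subset.trans (closure_minimal (Set.iUnion₂_subset fun n _ => hpow n) hM)

theorem IsAdapted.apply_eq_apply_one_of_forall_mem_supp {τ : Measure K} (hτ : IsAdapted τ)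
    {Y : Type*} [TopologicalSpace Y] [T2Space Y] {h : K → Y} (hh : Continuous h)
    (hτh : ∀ y ∈ τ.support, ∀ x, ∀ t ∈ supp y x, h t = h x) (x : K) : h x = h one := by
  have huniv : {y : K | ∀ x, ∀ t ∈ supp y x, h t = h x} = Set.univ := by
    refine hτ.eq_univ_of_isClosed ?_ hτh ?_ ?_ ?_
    · rw [Set.ofPred_forall]
      exact isClosed_iInter fun x =>
        isClosed_setOf_forall_mem_supp (E := {q | h q.2 = h x}) continuous_id continuous_const
          (isClosed_eq (hh.comp continuous_snd) continuous_const)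
    · intro x t ht
      rw [supp_one_left] at ht
      rw [Set.mem_singleton_iff.1 ht]
    · exact fun y hy x t ht => (hy t x (mem_supp_of_mem_supp_inv ht)).symm
    · intro y hy x t ht
      obtain ⟨a, ha, b, hb, hy⟩ := mem_setMul.1 hy
      obtain ⟨s, hs, hts⟩ := exists_mem_supp_of_mem_supp hy ht
      exact (ha s t hts).trans (hb x s hs)
  exact (huniv.symm.subset (Set.mem_univ x)) one x (by simp [supp_one_right])

/-- Left invariance of a measure, tested against real functions: `δ_x * ν = ν` for all `x`. -/
def IsLeftInvariant (ν : Measure K) : Prop :=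
  ∀ (x : K) (g : C_c(K, ℝ)), ∫ t, ∫ u, g u ∂(conv x t : Measure K) ∂ν = ∫ t, g t ∂ν

theorem IsLeftHaar.isLeftInvariant {ω : Measure K} [ω.Regular] (hω : IsLeftHaar ω) :
    IsLeftInvariant ω := by
  intro x g
  have h := hω.left_invariant x (g.compLeft (Complex.ofRealCLM : C(ℝ, ℂ)))
  simp only [translate, compLeft_ofRealCLM_apply, integral_complex_ofReal] at h
  exact_mod_cast h

end LocallyCompact

section Compact

variable {K : Type*} [TopologicalSpace K] [T2Space K] [CompactSpace K]
  [MeasurableSpace K] [BorelSpace K] [Hypergroup K]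

theorem continuous_integral_conv_comp {X : Type*} [TopologicalSpace X] {g : K → ℝ}
    (hg : Continuous g) {a b : X → K} (ha : Continuous a) (hb : Continuous b) :
    Continuous fun x => ∫ t, g t ∂(conv (a x) (b x) : Measure K) :=
  (continuous_integral_conv (.mkOfCompact ⟨g, hg⟩)).comp (ha.prodMk hb)

theorem integral_conv_assoc_of_continuous {g : K → ℝ} (hg : Continuous g) (x y z : K) :
    ∫ s, (∫ t, g t ∂(conv s z : Measure K)) ∂(conv x y : Measure K) =
      ∫ s, (∫ t, g t ∂(conv x s : Measure K)) ∂(conv y z : Measure K) :=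
  integral_conv_assoc_real ⟨⟨g, hg⟩, .of_compactSpace g⟩ x y z

theorem IsLeftInvariant.integral_integral_conv {ν : Measure K} (hν : IsLeftInvariant ν) (x : K)
    {g : K → ℝ} (hg : Continuous g) :
    ∫ t, ∫ u, g u ∂(conv x t : Measure K) ∂ν = ∫ t, g t ∂ν :=
  hν x ⟨⟨g, hg⟩, .of_compactSpace g⟩

theorem IsLeftInvariant.integral_integral_conv_map_inv {ν : Measure K} (hν : IsLeftInvariant ν)
    (s : K) {g : K → ℝ} (hg : Continuous g) :
    ∫ t, ∫ u, g u ∂(conv t s : Measure K) ∂(ν.map inv) = ∫ t, g t ∂(ν.map inv) := by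
  rw [integral_map_inv, integral_map_inv,
    ← hν.integral_integral_conv (inv s) (g := fun t => g (inv t)) (hg.comp continuous_inv)]
  refine integral_congr_ae (.of_forall fun t => ?_)
  simp only [← integral_map_inv, map_inv_conv, inv_inv]

theorem IsLeftInvariant.supp_subset_support {ν : Measure K} [ν.Regular]
    (hν : IsLeftInvariant ν) (x : K) {y : K} (hy : y ∈ ν.support) : supp x y ⊆ ν.support := by
  intro z hz
  by_contra hzν
  obtain ⟨g, hg_zero, hg_one, hg⟩ := exists_continuous_zero_one_of_isClosed
    Measure.isClosed_support isClosed_singleton (Set.disjoint_singleton_right.2 hzν)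
  have hg₀ : 0 ≤ ⇑g := fun w => (hg w).1
  have htranslate : Continuous fun t => ∫ u, g u ∂(conv x t : Measure K) :=
    continuous_integral_conv_comp g.continuous continuous_const continuous_id
  have hint : ∫ t, ∫ u, g u ∂(conv x t : Measure K) ∂ν = 0 := by
    rw [hν.integral_integral_conv x g.continuous]
    exact integral_eq_zero_of_ae (Filter.mem_of_superset Measure.support_mem_ae_of_regular hg_zero)
  have hy_int : ∫ u, g u ∂(conv x y : Measure K) = 0 :=
    eq_zero_of_mem_support_of_integral_eq_zero htranslate (fun t => integral_nonneg hg₀)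
      (integrable_of_continuous htranslate) hint hy
  have hgz : g z = 0 := eq_zero_of_mem_support_of_integral_eq_zero g.continuous hg₀
    (integrable_of_continuous g.continuous) hy_int hz
  simp [hg_one rfl] at hgz

theorem IsLeftInvariant.support_eq_univ {ν : Measure K} [ν.Regular]
    (hν : IsLeftInvariant ν) (hν₀ : ν ≠ 0) : ν.support = Set.univ := by
  obtain ⟨y, hy⟩ := nonempty_support_of_regular hν₀
  refine Set.eq_univ_of_forall fun z => ?_
  obtain ⟨x, hx⟩ : (supp z (inv y)).Nonempty :=
    nonempty_support_of_regular (IsProbabilityMeasure.ne_zero _)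
  refine hν.supp_subset_support x hy ?_
  simpa only [inv_inv] using mem_supp_inv_of_mem_supp hx

theorem IsLeftInvariant.smul_eq_smul {ω ν : Measure K} [ω.Regular] [ν.Regular]
    (hω : IsLeftInvariant ω) (hν : IsLeftInvariant ν) :
    ω Set.univ • ν = ν Set.univ • ω := by
  obtain rfl | hω₀ := eq_or_ne ω 0
  · simp
  -- Both sides are the integral of `g (z * t)` against `ω̌ ⊗ μ`.
  have key {μ : Measure K} [IsFiniteMeasure μ] (hμ : IsLeftInvariant μ) {g : K → ℝ}
      (hg : Continuous g) :
      ω.real Set.univ * ∫ t, g t ∂μ = μ.real Set.univ * ∫ t, g (inv t) ∂ω := by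
    have h := integral_integral_swap_of_hasCompactSupport (μ := ω.map inv) (ν := μ)
      (f := fun z t => ∫ u, g u ∂(conv z t : Measure K))
      (continuous_integral_conv_comp hg continuous_fst continuous_snd) (.of_compactSpace _)
    simp only [hμ.integral_integral_conv _ hg, hω.integral_integral_conv_map_inv _ hg,
      integral_const, smul_eq_mul] at h
    rwa [integral_map_inv, map_measureReal_apply continuous_inv.measurable .univ,
      Set.preimage_univ] at h
  have := Measure.Regular.smul (μ := ν) (measure_ne_top ω Set.univ)
  have := Measure.Regular.smul (μ := ω) (measure_ne_top ν Set.univ)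
  refine Measure.ext_of_integral_eq_on_compactlySupported fun g => ?_
  have hinv : ∫ t, g t ∂ω = ∫ t, g (inv t) ∂ω :=
    mul_left_cancel₀ (by simpa [measureReal_eq_zero_iff] using hω₀) (key hω g.continuous)
  rw [integral_smul_measure, integral_smul_measure, hinv]
  exact key hν g.continuous

/-- The Markov kernel `y ↦ δ_y * δ_x`. -/
noncomputable def rightTranslation (x : K) : Kernel K K :=
  fellerKernel ⟨fun y => conv y x, continuous_conv.comp (.prodMk_left x)⟩ fun y => regular_conv y x

instance (x : K) : IsMarkovKernel (rightTranslation x) :=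
  inferInstanceAs (IsMarkovKernel (fellerKernel _ _))

instance (τ : Measure K) [IsFiniteMeasure τ] [τ.WeaklyRegular] (x : K) :
    (rightTranslation x ∘ₘ τ).Regular :=
  inferInstanceAs (fellerKernel _ _ ∘ₘ τ).Regular

theorem integral_rightTranslation_comp {τ : Measure K} {x : K} {E : Type*} [NormedAddCommGroup E]
    [NormedSpace ℝ E] {f : K → E} (hf : Integrable f (rightTranslation x ∘ₘ τ)) :
    ∫ t, f t ∂(rightTranslation x ∘ₘ τ) = ∫ y, ∫ t, f t ∂(conv y x : Measure K) ∂τ :=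
  integral_kernel_comp hf

theorem continuous_rightTranslation_comp (τ : Measure K) [IsProbabilityMeasure τ] :
    Continuous (Y := ProbabilityMeasure K) fun x => ⟨rightTranslation x ∘ₘ τ, inferInstance⟩ := by
  refine ProbabilityMeasure.continuous_iff_forall_continuous_integral.2 fun g => ?_
  simp only [ProbabilityMeasure.coe_mk,
    integral_rightTranslation_comp (integrable_of_continuous g.continuous)]
  exact continuous_integral_of_continuous_uncurry τ
    (continuous_integral_conv_comp g.continuous continuous_snd continuous_fst)

section Walk
variable (τ : Measure K) [IsProbabilityMeasure τ] [τ.WeaklyRegular]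

/-- The random walk with law `τ`: its transition probabilities are the measures `τ * δ_x`. -/
noncomputable def walk : Kernel K K :=
  fellerKernel ⟨_, continuous_rightTranslation_comp τ⟩ fun x =>
    inferInstanceAs (rightTranslation x ∘ₘ τ).Regular

instance : IsMarkovKernel (walk τ) := inferInstanceAs (IsMarkovKernel (fellerKernel _ _))

instance (μ : Measure K) [IsFiniteMeasure μ] [μ.WeaklyRegular] : (walk τ ∘ₘ μ).Regular :=
  inferInstanceAs (fellerKernel _ _ ∘ₘ μ).Regular

theorem walk_apply (x : K) : walk τ x = rightTranslation x ∘ₘ τ := rfl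

variable {τ}

theorem integral_walk {x : K} {E : Type*} [NormedAddCommGroup E] [NormedSpace ℝ E] {f : K → E}
    (hf : Integrable f (walk τ x)) :
    ∫ t, f t ∂walk τ x = ∫ y, ∫ t, f t ∂(conv y x : Measure K) ∂τ :=
  integral_rightTranslation_comp hf

theorem IsLeftInvariant.invariant_walk {ω : Measure K} [ω.Regular] (hω : IsLeftInvariant ω) :
    (walk τ).Invariant ω := by
  refine Measure.ext_of_integral_eq_on_compactlySupported fun g => ?_
  have hg {μ : Measure K} [IsFiniteMeasure μ] : Integrable g μ :=
    integrable_of_continuous g.continuous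
  calc ∫ t, g t ∂(walk τ ∘ₘ ω) = ∫ x, ∫ y, ∫ t, g t ∂(conv y x : Measure K) ∂τ ∂ω := by
        simp only [integral_kernel_comp hg, integral_walk hg]
    _ = ∫ y, ∫ x, ∫ t, g t ∂(conv y x : Measure K) ∂ω ∂τ :=
        integral_integral_swap_of_hasCompactSupport
          (f := fun x y : K => ∫ t, g t ∂(conv y x : Measure K))
          (continuous_integral_conv_comp g.continuous continuous_snd continuous_fst)
          (.of_compactSpace _)
    _ = ∫ t, g t ∂ω := by
        simp only [hω.integral_integral_conv _ (g := g) g.continuous, integral_const,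
          probReal_univ, one_smul]

end Walk

theorem integral_walk_integral_conv_inv {τ ν : Measure K} [IsProbabilityMeasure τ] [τ.Regular]
    [IsFiniteMeasure ν] (hν : (walk (τ.map inv)).Invariant ν) {g : K → ℝ} (hg : Continuous g)
    (x : K) :
    ∫ w, ∫ t, ∫ u, g u ∂(conv (inv w) t : Measure K) ∂ν ∂walk τ x =
      ∫ t, ∫ u, g u ∂(conv (inv x) t : Measure K) ∂ν := by
  have hν' : walk (τ.map inv) ∘ₘ ν = ν := hν
  have hG {a b : K × K → K} (ha : Continuous a) (hb : Continuous b) :=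
    continuous_integral_conv_comp hg ha hb
  have htranslate (x : K) : Continuous fun t => ∫ u, g u ∂(conv x t : Measure K) :=
    continuous_integral_conv_comp hg continuous_const continuous_id
  calc ∫ w, ∫ t, ∫ u, g u ∂(conv (inv w) t : Measure K) ∂ν ∂walk τ x
      = ∫ y, ∫ w, ∫ t, ∫ u, g u ∂(conv (inv w) t : Measure K) ∂ν ∂(conv y x : Measure K) ∂τ :=
        integral_walk <| integrable_of_continuous <| continuous_integral_of_continuous_uncurry ν <|
          hG (continuous_inv.comp continuous_fst) continuous_snd
    _ = ∫ y, ∫ w, ∫ t, ∫ u, g u ∂(conv w t : Measure K) ∂ν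
          ∂(conv (inv x) (inv y) : Measure K) ∂τ := by
        simp only [← map_inv_conv, integral_map_inv]
    _ = ∫ y, ∫ t, ∫ w, ∫ u, g u ∂(conv w t : Measure K) ∂(conv (inv x) (inv y) : Measure K)
          ∂ν ∂τ := by
        congr! 2 with y
        exact integral_integral_swap_of_hasCompactSupport (hG continuous_fst continuous_snd)
          (.of_compactSpace _)
    _ = ∫ y, ∫ t, ∫ w, ∫ u, g u ∂(conv (inv x) w : Measure K) ∂(conv (inv y) t : Measure K)
          ∂ν ∂τ := by
        simp only [integral_conv_assoc_of_continuous hg]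
    _ = ∫ t, ∫ y, ∫ w, ∫ u, g u ∂(conv (inv x) w : Measure K) ∂(conv (inv y) t : Measure K)
          ∂τ ∂ν :=
        integral_integral_swap_of_hasCompactSupport
          (continuous_integral_conv_comp (htranslate (inv x))
            (continuous_inv.comp continuous_fst) continuous_snd) (.of_compactSpace _)
    _ = ∫ t, ∫ w, ∫ u, g u ∂(conv (inv x) w : Measure K) ∂walk (τ.map inv) t ∂ν := by
        simp only [integral_walk (integrable_of_continuous (htranslate (inv x))), integral_map_inv]
    _ = ∫ t, ∫ u, g u ∂(conv (inv x) t : Measure K) ∂ν := by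
        rw [← integral_kernel_comp (integrable_of_continuous (htranslate (inv x))), hν']

theorem forall_mem_supp_eq_of_harmonic {ω τ : Measure K} [ω.Regular] [IsProbabilityMeasure τ]
    [τ.Regular] (hω : IsLeftInvariant ω) (hω₀ : ω ≠ 0) {E : Type*} [NormedAddCommGroup E]
    [InnerProductSpace ℝ E] [CompleteSpace E] {h : K → E} (hh : Continuous h)
    (hharm : ∀ᵐ x ∂ω, ∫ t, h t ∂walk τ x = h x) {y : K} (hy : y ∈ τ.support) (x : K) :
    ∀ t ∈ supp y x, h t = h x := by
  have hclosed (x : K) : IsClosed {t | h t = h x} := isClosed_eq hh continuous_const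
  have hall (x : K) : IsClosed {y | ∀ t ∈ supp y x, h t = h x} :=
    isClosed_setOf_forall_mem_supp (E := {q | h q.2 = h x}) continuous_id continuous_const
      ((hclosed x).preimage continuous_snd)
  have hyx : IsClosed {x | ∀ t ∈ supp y x, h t = h x} :=
    isClosed_setOf_forall_mem_supp (E := {q | h q.2 = h q.1}) continuous_const continuous_id
      (isClosed_eq (hh.comp continuous_snd) (hh.comp continuous_fst))
  have hae : ∀ᵐ x ∂ω, ∀ t ∈ supp y x, h t = h x := by
    filter_upwards [ae_ae_eq_of_ae_integral_eq hω.invariant_walk (integrable_of_continuous hh)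
      hharm] with x hx
    rw [walk_apply] at hx
    refine Measure.support_subset_of_isClosed (hall x) ?_ hy
    filter_upwards [Measure.ae_ae_of_ae_comp hx] with y hy
    exact fun t ht => Measure.support_subset_of_isClosed (hclosed x) hy ht
  exact (hω.support_eq_univ hω₀).symm.subset.trans
    (Measure.support_subset_of_isClosed hyx hae) (Set.mem_univ x)

theorem IsLeftInvariant.of_invariant_walk {ω τ ν : Measure K} [ω.Regular]
    [IsProbabilityMeasure τ] [τ.Regular] [IsFiniteMeasure ν] (hω : IsLeftInvariant ω)
    (hω₀ : ω ≠ 0) (hτ : IsAdapted τ) (hν : (walk (τ.map inv)).Invariant ν) :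
    IsLeftInvariant ν := by
  intro x g
  let h (w : K) : ℝ := ∫ t, ∫ u, g u ∂(conv (inv w) t : Measure K) ∂ν
  have hh : Continuous h := continuous_integral_of_continuous_uncurry ν <|
    continuous_integral_conv_comp g.continuous (continuous_inv.comp continuous_fst) continuous_snd
  have hconst : h (inv x) = h one :=
    hτ.apply_eq_apply_one_of_forall_mem_supp hh (fun y hy =>
      forall_mem_supp_eq_of_harmonic hω hω₀ hh
        (.of_forall (integral_walk_integral_conv_inv hν g.continuous)) hy) (inv x)
  simpa [h, inv_inv, inv_one, one_conv] using hconst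

theorem measure_eq_zero_or_measure_compl_eq_zero_of_ae_ae_mem_iff {ω σ : Measure K} [ω.Regular]
    [IsProbabilityMeasure σ] [σ.Regular] (hω : IsLeftInvariant ω) (hσ : IsAdapted σ) {A : Set K}
    (hA : MeasurableSet A)
    (h : ∀ᵐ x ∂ω, ∀ᵐ y ∂walk (σ.map inv) x, y ∈ A ↔ x ∈ A) : ω A = 0 ∨ ω Aᶜ = 0 := by
  obtain rfl | hω₀ := eq_or_ne ω 0
  · simp
  have : (ω.restrict A).Regular := .restrict_of_measure_ne_top (measure_ne_top ω A)
  have hinvt : IsLeftInvariant (ω.restrict A) :=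
    hω.of_invariant_walk hω₀ hσ (invariant_restrict hω.invariant_walk hA h)
  have hprod := DFunLike.congr_fun (hω.smul_eq_smul hinvt) Aᶜ
  simpa [hA.compl, eq_comm] using hprod

theorem ae_measureConv_eq_integral_walk {ω σ : Measure K} [ω.Regular]
    [IsProbabilityMeasure σ] [σ.Regular] (hω : IsLeftInvariant ω) {f : K → ℂ}
    (hf : Integrable f ω) :
    ∀ᵐ x ∂ω, measureConv σ f x = ∫ t, f t ∂walk (σ.map inv) x := by
  have hωP : walk (σ.map inv) ∘ₘ ω = ω := hω.invariant_walk
  filter_upwards [Measure.ae_integrable_of_integrable_comp (hωP.symm ▸ hf)] with x hx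
  rw [integral_walk hx, integral_map_inv]
  rfl

theorem exists_ae_eq_const_of_measureConv_ae_eq {ω σ : Measure K} [ω.Regular]
    [IsProbabilityMeasure σ] [σ.Regular] (hω : IsLeftInvariant ω) (hσ : IsAdapted σ) {f : K → ℂ}
    (hf_meas : Measurable f) (hf : Integrable f ω) (hharm : measureConv σ f =ᵐ[ω] f) :
    ∃ c, f =ᵐ[ω] Function.const K c := by
  have hae : ∀ᵐ x ∂ω, ∀ᵐ y ∂walk (σ.map inv) x, f y = f x := by
    refine ae_ae_eq_of_ae_integral_eq hω.invariant_walk hf ?_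
    filter_upwards [ae_measureConv_eq_integral_walk (σ := σ) hω hf, hharm] with x hx hfx
    rw [← hx, hfx]
  refine Filter.exists_eventuallyEq_const_of_forall_separating MeasurableSet fun U hU => ?_
  have h := measure_eq_zero_or_measure_compl_eq_zero_of_ae_ae_mem_iff hω hσ (hf_meas hU) <|
    hae.mono fun x hx => hx.mono fun y hy => by simp [hy]
  exact h.symm.imp mem_ae_iff.2 measure_eq_zero_iff_ae_notMem.1

theorem measureConv_ae_eq_of_ae_eq_const {ω σ : Measure K} [ω.Regular]
    [IsProbabilityMeasure σ] [σ.Regular] (hω : IsLeftInvariant ω) {f : K → ℂ} {c : ℂ}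
    (hf : f =ᵐ[ω] Function.const K c) : measureConv σ f =ᵐ[ω] f := by
  have hωP : walk (σ.map inv) ∘ₘ ω = ω := hω.invariant_walk
  filter_upwards [ae_measureConv_eq_integral_walk (σ := σ) hω
    ((integrable_const c).congr hf.symm), Measure.ae_ae_of_ae_comp (hωP.symm ▸ hf), hf]
    with x hx hfx hfc
  rw [hx, integral_congr_ae hfx, hfc]
  simp

end Compact

end Hypergroup

theorem mainTheorem5 {K : Type*} [TopologicalSpace K] [T2Space K] [CompactSpace K]
    [MeasurableSpace K] [BorelSpace K] [Hypergroup K]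
    (ω : Measure K) [ω.Regular] (hω : Hypergroup.IsLeftHaar ω)
    (σ : Measure K) [IsProbabilityMeasure σ] [σ.Regular] (hσ : Hypergroup.IsAdapted σ)
    (p : ℝ≥0∞) (hp : 1 ≤ p) :
    Hypergroup.harmonicLp σ ω p = Set.range (Lp.const p ω : ℂ → Lp ℂ p ω) := by
  ext f
  refine ⟨fun hf => ?_, ?_⟩
  · obtain ⟨c, hc⟩ := Hypergroup.exists_ae_eq_const_of_measureConv_ae_eq hω.isLeftInvariant
      hσ (Lp.stronglyMeasurable f).measurable ((Lp.memLp f).integrable hp) hf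
    exact ⟨c, Lp.ext ((Lp.coeFn_const p ω c).trans hc.symm)⟩
  · rintro ⟨c, rfl⟩
    exact Hypergroup.measureConv_ae_eq_of_ae_eq_const hω.isLeftInvariant (Lp.coeFn_const p ω c)
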